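/- Let $\overline{X}$ be a real $n\times m$ matrix of rank $r$, and let $\overline{I}=\{(i,j): \overline{X}_{ij}=0\}$. Let $\mathcal{G}$ be the bipartite graph on $n+m$ vertices, one for each row and one for each column, in which row $i$ is adjacent to column $j$ exactly when $(i,j)\notin\overline{I}$, and let $c(\mathcal{G})$ be the number of its connected components (isolated vertices included). Let $\alpha$ and $\beta$ be the numbers of nonzero rows and of nonzero columns of $\overline{X}$. Then there exists a $C^\infty$ embedded submanifold $\mathcal{M}$ of $\mathbf{R}^{n\times m}$, of dimension $n+m-c(\mathcal{G})$, satisfying $$\overline{X}\in\mathcal{M}\subset\{X:\ \operatorname{rank}X=r \text{ and } X_{ij}=0 \text{ for all } (i,j)\in\overline{I}\}.$$ Moreover, for this $\mathcal{M}$ there exists a linear subspace $\mathcal{V}$ of $\mathbf{R}^{n\times m}$ with $\dim\mathcal{V}\ge\max\{\alpha,\beta\}$ satisfying $$\overline{X}\in\mathcal{V}\subset\operatorname{cl}\mathcal{M}\subset\{X:\ \operatorname{rank}X\le r \text{ and } X_{ij}=0 \text{ for all } (i,j)\in\overline{I}\}.$$ -/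

import Mathlib

open scoped ContDiff

/-- A subset `M` of a finite-dimensional real normed space `E` is an (embedded) `C^∞` submanifold
of dimension `k`: around each of its points there is a `C^∞` diffeomorphism `φ` between open
subsets of `E` which straightens `M` to a `k`-dimensional linear subspace `S`. -/
def IsSmoothSubmanifold {E : Type*} [NormedAddCommGroup E] [NormedSpace ℝ E]
    (k : ℕ) (M : Set E) : Prop :=
  ∀ x ∈ M, ∃ (φ : OpenPartialHomeomorph E E) (S : Submodule ℝ E),
    x ∈ φ.source ∧
    ContDiffOn ℝ ∞ φ φ.source ∧
    ContDiffOn ℝ ∞ φ.symm φ.target ∧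
    Module.finrank ℝ S = k ∧
    ∀ y ∈ φ.source, y ∈ M ↔ φ y ∈ S

/-- The bipartite graph of a matrix: one vertex per row and one per column, and row `i` is joined
to column `j` exactly when the entry `X i j` is nonzero. -/
def entryGraph {n m : ℕ} (X : Matrix (Fin n) (Fin m) ℝ) : SimpleGraph (Fin n ⊕ Fin m) where
  Adj a b := ∃ i j, X i j ≠ 0 ∧
    ((a = Sum.inl i ∧ b = Sum.inr j) ∨ (a = Sum.inr j ∧ b = Sum.inl i))
  symm := ⟨by
    rintro a b ⟨i, j, h, h'⟩
    exact ⟨i, j, h, h'.symm.imp And.symm And.symm⟩⟩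
  loopless := ⟨by
    rintro a ⟨i, j, -, ⟨rfl, h⟩ | ⟨rfl, h⟩⟩ <;> simp at h⟩

/-- The number of connected components of a graph (isolated vertices included). -/
noncomputable def numComponents {V : Type*} (G : SimpleGraph V) : ℕ :=
  Nat.card G.ConnectedComponent

/- Smoothness does not depend on the norm on the finite-dimensional space of matrices; the
entrywise sup norm, which induces the usual topology, is used. -/
attribute [local instance] Matrix.normedAddCommGroup Matrix.normedSpace

/-!
The manifold is the orbit of `X₀` under nonsingular diagonal row and column scalings, that is, the
set of all matrices `(uᵢ vⱼ X₀ᵢⱼ)` with `u` and `v` nowhere zero. Scalings preserve the rank and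
the zero pattern, and both conditions (rank at most `rank X₀`, zero outside the support) are closed.

Near a point `x` of the orbit, take the logarithm of `yᵢⱼ / xᵢⱼ` at the entries of the support of
`X₀` and leave the other entries alone (`logChart`). This is a diffeomorphism from the open set of
matrices having the signs of `x` on the support onto the whole space, and it carries the orbit to
the linear space of matrices equal to `aᵢ + bⱼ` on the support and to `0` outside it
(`logChart_mem_range_iff`). That space is the image of `ℝ ^ (n + m)` under a linear map
(`edgeSum`) whose kernel consists of the vertex functions which change sign along every edge of
the bipartite graph. After a change of sign on the columns these are the functions constant on
connected components, so the dimension is `n + m` minus the number of components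
(`finrank_range_edgeSum`).

For the linear subspace, take all row scalings `diag(a) X₀`, or all column scalings `X₀ diag(b)`,
with arbitrary `a` or `b`: these are limits of nonsingular scalings, and the scalings of the nonzero
rows (columns) are linearly independent.
-/

variable {n m : ℕ}

/-! ### Scaling orbits -/

/-- The matrix `diag(u) X diag(v)`, written entrywise. -/
def scale (X : Matrix (Fin n) (Fin m) ℝ) (u : Fin n → ℝ) (v : Fin m → ℝ) :
    Matrix (Fin n) (Fin m) ℝ :=
  Matrix.of fun i j => u i * v j * X i j

/-- The orbit of `X` under nonsingular diagonal scalings of rows and columns. Factors of either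
sign are allowed, so that the closure of the orbit contains linear subspaces. -/
def scalingOrbit (X : Matrix (Fin n) (Fin m) ℝ) : Set (Matrix (Fin n) (Fin m) ℝ) :=
  {Y | ∃ u v, (∀ i, u i ≠ 0) ∧ (∀ j, v j ≠ 0) ∧ Y = scale X u v}

theorem scale_apply (X : Matrix (Fin n) (Fin m) ℝ) (u : Fin n → ℝ) (v : Fin m → ℝ)
    (i : Fin n) (j : Fin m) : scale X u v i j = u i * v j * X i j := rfl

theorem scale_one_one (X : Matrix (Fin n) (Fin m) ℝ) : scale X 1 1 = X := by
  ext i j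
  simp [scale_apply]

theorem self_mem_scalingOrbit (X : Matrix (Fin n) (Fin m) ℝ) : X ∈ scalingOrbit X :=
  ⟨1, 1, by simp, by simp, (scale_one_one X).symm⟩

theorem scale_eq_mul (X : Matrix (Fin n) (Fin m) ℝ) (u : Fin n → ℝ) (v : Fin m → ℝ) :
    scale X u v = Matrix.diagonal u * X * Matrix.diagonal v := by
  ext i j
  simp only [scale_apply, Matrix.mul_diagonal, Matrix.diagonal_mul]
  ring

theorem rank_of_mem_scalingOrbit {X Y : Matrix (Fin n) (Fin m) ℝ} (h : Y ∈ scalingOrbit X) :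
    Y.rank = X.rank := by
  obtain ⟨u, v, hu, hv, rfl⟩ := h
  rw [scale_eq_mul, Matrix.rank_mul_eq_left_of_isUnit_det, Matrix.rank_mul_eq_right_of_isUnit_det]
  · simpa [Matrix.det_diagonal, Finset.prod_eq_zero_iff] using hu
  · simpa [Matrix.det_diagonal, Finset.prod_eq_zero_iff] using hv

theorem isClosed_setOf_rank_le (r : ℕ) :
    IsClosed {X : Matrix (Fin n) (Fin m) ℝ | X.rank ≤ r} := by
  let L : Matrix (Fin n) (Fin m) ℝ →ₗ[ℝ] ((Fin m → ℝ) →L[ℝ] (Fin n → ℝ)) :=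
    LinearMap.toContinuousLinearMap.toLinearMap ∘ₗ Matrix.toLin'.toLinearMap
  have hL : Continuous L := L.continuous_of_finiteDimensional
  have key := (isOpen_setOfPred_nat_le_rank (𝕜 := ℝ) (E := Fin m → ℝ) (F := Fin n → ℝ)
    (r + 1)).preimage hL
  rw [← isOpen_compl_iff]
  convert key using 1
  ext X
  have : ((L X : (Fin m → ℝ) →L[ℝ] (Fin n → ℝ)) : (Fin m → ℝ) →ₗ[ℝ] (Fin n → ℝ)).rank
      = (X.rank : Cardinal) := by
    rw [Matrix.rank, Module.finrank_eq_rank]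
    rfl
  simp only [Set.mem_compl_iff, Set.mem_ofPred_eq, Set.mem_preimage, this]
  norm_cast
  omega

theorem closure_scalingOrbit_subset (X : Matrix (Fin n) (Fin m) ℝ) :
    closure (scalingOrbit X) ⊆ {Y | Y.rank ≤ X.rank ∧ ∀ i j, X i j = 0 → Y i j = 0} := by
  refine closure_minimal ?_ ?_
  · intro Y hY
    refine ⟨(rank_of_mem_scalingOrbit hY).le, ?_⟩
    obtain ⟨u, v, -, -, rfl⟩ := hY
    intro i j h
    simp [scale_apply, h]
  · have hzero : IsClosed {Y : Matrix (Fin n) (Fin m) ℝ | ∀ i j, X i j = 0 → Y i j = 0} := by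
      simp only [Set.ofPred_forall]
      exact isClosed_iInter fun i => isClosed_iInter fun j => isClosed_iInter fun _ =>
        isClosed_eq (continuous_id.matrix_elem i j) continuous_const
    exact (isClosed_setOf_rank_le _).inter hzero

/-! ### Linear subspaces in the closure of the orbit -/

/-- All scalings, singular ones included, are limits of nonsingular ones. -/
theorem scale_mem_closure (X : Matrix (Fin n) (Fin m) ℝ) (u : Fin n → ℝ) (v : Fin m → ℝ) :
    scale X u v ∈ closure (scalingOrbit X) := by
  have hdense (k : ℕ) : Dense {w : Fin k → ℝ | ∀ i, w i ≠ 0} := by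
    have := dense_pi (ι := Fin k) (α := fun _ => ℝ) Set.univ
      (s := fun _ => {(0 : ℝ)}ᶜ) fun i _ => dense_compl_singleton 0
    simpa [Set.pi] using this
  have hcont : Continuous fun p : (Fin n → ℝ) × (Fin m → ℝ) => scale X p.1 p.2 := by
    unfold scale
    refine continuous_matrix fun i j => ?_
    simp only [Matrix.of_apply]
    fun_prop
  have hd := (hdense n).prod (hdense m)
  refine map_mem_closure (x := (u, v)) hcont (hd (u, v)) ?_
  rintro ⟨a, b⟩ ⟨ha, hb⟩
  exact ⟨a, b, ha, hb, rfl⟩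

/-- The row scalings of a matrix, as a linear function of the scaling factors. -/
def rowScale (X : Matrix (Fin n) (Fin m) ℝ) : (Fin n → ℝ) →ₗ[ℝ] Matrix (Fin n) (Fin m) ℝ where
  toFun u := scale X u 1
  map_add' u u' := by ext i j; simp [scale_apply, add_mul]
  map_smul' c u := by ext i j; simp [scale_apply, mul_assoc]

/-- The column scalings of a matrix, as a linear function of the scaling factors. -/
def colScale (X : Matrix (Fin n) (Fin m) ℝ) : (Fin m → ℝ) →ₗ[ℝ] Matrix (Fin n) (Fin m) ℝ where
  toFun v := scale X 1 v
  map_add' v v' := by ext i j; simp [scale_apply, add_mul]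
  map_smul' c v := by ext i j; simp [scale_apply, mul_assoc]

/-- A linear map on functions has rank at least the size of any set `s` of coordinates such that
the coordinates in `s` vanish on the kernel. -/
theorem ncard_le_finrank_range {ι E : Type*} [Fintype ι] [AddCommGroup E]
    [Module ℝ E] (L : (ι → ℝ) →ₗ[ℝ] E) (s : Set ι) (h : ∀ w, L w = 0 → ∀ i ∈ s, w i = 0) :
    s.ncard ≤ Module.finrank ℝ (LinearMap.range L) := by
  -- The functions supported on `s` inject into the range.
  have hinj : Function.Injective (L.rangeRestrict ∘ₗ Function.ExtendByZero.linearMap ℝ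
      (Subtype.val : s → ι)) := by
    rw [injective_iff_map_eq_zero]
    intro w hw
    ext i
    have := h _ (congrArg Subtype.val hw) i i.2
    simpa [Subtype.val_injective.extend_apply] using this
  have hle := LinearMap.finrank_le_finrank_of_injective hinj
  have : Fintype s := Fintype.ofFinite s
  rwa [Module.finrank_fintype_fun_eq_card, ← Nat.card_eq_fintype_card] at hle

theorem ncard_rows_le (X : Matrix (Fin n) (Fin m) ℝ) :
    {i | X.row i ≠ 0}.ncard ≤ Module.finrank ℝ (LinearMap.range (rowScale X)) := by
  refine ncard_le_finrank_range _ _ fun u hu i hi => ?_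
  obtain ⟨j, hj⟩ := Function.ne_iff.mp hi
  have h : scale X u 1 i j = 0 := congrFun (congrFun hu i) j
  have hj' : X i j ≠ 0 := hj
  simpa [scale_apply, hj'] using h

theorem ncard_cols_le (X : Matrix (Fin n) (Fin m) ℝ) :
    {j | X.col j ≠ 0}.ncard ≤ Module.finrank ℝ (LinearMap.range (colScale X)) := by
  refine ncard_le_finrank_range _ _ fun v hv j hj => ?_
  obtain ⟨i, hi⟩ := Function.ne_iff.mp hj
  have h : scale X 1 v i j = 0 := congrFun (congrFun hv i) j
  have hi' : X i j ≠ 0 := hi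
  simpa [scale_apply, hi'] using h

/-! ### The tangent space and its dimension -/

open Classical in
/-- The linear map sending a function on the vertices of the bipartite graph of `X` to the matrix
of its sums over the two ends of each edge. -/
noncomputable def edgeSum (X : Matrix (Fin n) (Fin m) ℝ) :
    (Fin n ⊕ Fin m → ℝ) →ₗ[ℝ] Matrix (Fin n) (Fin m) ℝ where
  toFun f := Matrix.of fun i j => if X i j = 0 then 0 else f (Sum.inl i) + f (Sum.inr j)
  map_add' f g := by
    ext i j
    by_cases h : X i j = 0 <;> simp [h]
    ring
  map_smul' c f := by
    ext i j
    by_cases h : X i j = 0 <;> simp [h, mul_add]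

open Classical in
theorem edgeSum_apply (X : Matrix (Fin n) (Fin m) ℝ) (f : Fin n ⊕ Fin m → ℝ)
    (i : Fin n) (j : Fin m) :
    edgeSum X f i j = if X i j = 0 then 0 else f (Sum.inl i) + f (Sum.inr j) := rfl

/-- The sign of a vertex of the bipartite graph: `1` on rows and `-1` on columns. -/
def sideSign : Fin n ⊕ Fin m → ℝ := Sum.elim (fun _ => 1) (fun _ => -1)

theorem sideSign_mul_self (a : Fin n ⊕ Fin m) : sideSign a * sideSign a = 1 := by
  cases a <;> simp [sideSign]

/-- Functions on the set of components, pulled back to the vertices with opposite signs on the two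
sides of the bipartition. -/
def signedPullback (X : Matrix (Fin n) (Fin m) ℝ) :
    ((entryGraph X).ConnectedComponent → ℝ) →ₗ[ℝ] (Fin n ⊕ Fin m → ℝ) where
  toFun g a := sideSign a * g ((entryGraph X).connectedComponentMk a)
  map_add' g g' := by ext a; simp [mul_add]
  map_smul' c g := by ext a; simp; ring

theorem signedPullback_apply (X : Matrix (Fin n) (Fin m) ℝ)
    (g : (entryGraph X).ConnectedComponent → ℝ) (a : Fin n ⊕ Fin m) :
    signedPullback X g a = sideSign a * g ((entryGraph X).connectedComponentMk a) := rfl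

theorem signedPullback_injective (X : Matrix (Fin n) (Fin m) ℝ) :
    Function.Injective (signedPullback X) := by
  intro g g' h
  ext c
  induction c using SimpleGraph.ConnectedComponent.ind with
  | _ a =>
    have := congrArg (sideSign a * ·) (congrFun h a)
    simpa only [signedPullback_apply, ← mul_assoc, sideSign_mul_self, one_mul] using this

/-- A function sums to zero over every edge exactly when its product with `sideSign` is constant
on connected components. -/
theorem ker_edgeSum (X : Matrix (Fin n) (Fin m) ℝ) :
    LinearMap.ker (edgeSum X) = LinearMap.range (signedPullback X) := by
  ext f
  constructor
  · intro hf
    have hedge : ∀ a b, (entryGraph X).Adj a b → sideSign a * f a = sideSign b * f b := by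
      have hs : ∀ i j, X i j ≠ 0 → f (Sum.inl i) + f (Sum.inr j) = 0 := by
        intro i j hij
        have h : edgeSum X f i j = 0 := congrFun (congrFun hf i) j
        simpa [edgeSum_apply, hij] using h
      rintro a b ⟨i, j, hij, ⟨rfl, rfl⟩ | ⟨rfl, rfl⟩⟩ <;>
        · have := hs i j hij
          simp only [sideSign, Sum.elim_inl, Sum.elim_inr]
          linarith
    have hwalk : ∀ a b (p : (entryGraph X).Walk a b), sideSign a * f a = sideSign b * f b := by
      intro a b p
      induction p with
      | nil => rfl
      | cons hadj _ ih => exact (hedge _ _ hadj).trans ih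
    refine ⟨SimpleGraph.ConnectedComponent.lift (fun a => sideSign a * f a)
      fun a b p _ => hwalk a b p, ?_⟩
    ext a
    rw [signedPullback_apply, SimpleGraph.ConnectedComponent.lift_mk, ← mul_assoc,
      sideSign_mul_self, one_mul]
  · rintro ⟨g, rfl⟩
    ext i j
    by_cases h : X i j = 0
    · simp [edgeSum_apply, h]
    · have hadj : (entryGraph X).Adj (Sum.inl i) (Sum.inr j) := ⟨i, j, h, Or.inl ⟨rfl, rfl⟩⟩
      have := SimpleGraph.ConnectedComponent.connectedComponentMk_eq_of_adj hadj
      simp [edgeSum_apply, h, signedPullback_apply, sideSign, this]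

theorem finrank_range_edgeSum (X : Matrix (Fin n) (Fin m) ℝ) :
    Module.finrank ℝ (LinearMap.range (edgeSum X)) = n + m - numComponents (entryGraph X) := by
  have hker : Module.finrank ℝ (LinearMap.ker (edgeSum X)) = numComponents (entryGraph X) := by
    have : Fintype (entryGraph X).ConnectedComponent := Fintype.ofFinite _
    rw [ker_edgeSum, LinearMap.finrank_range_of_inj (signedPullback_injective X),
      Module.finrank_fintype_fun_eq_card, numComponents, Nat.card_eq_fintype_card]
  have := (edgeSum X).finrank_range_add_finrank_ker
  rw [hker, Module.finrank_fintype_fun_eq_card, Fintype.card_sum, Fintype.card_fin,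
    Fintype.card_fin] at this
  omega

/-! ### Logarithmic charts -/

open Classical in
/-- The chart at `x`: the logarithm of the ratio to `x` at the entries where `x` does not vanish,
and the identity at the others. Its source is the set of matrices whose entries have the same sign
as those of `x` wherever the latter do not vanish. -/
noncomputable def logChart (x : Matrix (Fin n) (Fin m) ℝ) :
    OpenPartialHomeomorph (Matrix (Fin n) (Fin m) ℝ) (Matrix (Fin n) (Fin m) ℝ) where
  toFun y := Matrix.of fun i j => if x i j = 0 then y i j else Real.log (y i j / x i j)
  invFun z := Matrix.of fun i j => if x i j = 0 then z i j else x i j * Real.exp (z i j)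
  source := {y | ∀ i j, x i j ≠ 0 → 0 < y i j / x i j}
  target := Set.univ
  map_source' _ _ := Set.mem_univ _
  map_target' z _ := by
    intro i j h
    simp [h, Real.exp_pos]
  left_inv' y hy := by
    ext i j
    by_cases h : x i j = 0
    · simp [h]
    · simp [h, Real.exp_log (hy i j h), mul_div_cancel₀]
  right_inv' z _ := by
    ext i j
    by_cases h : x i j = 0 <;> simp [h]
  open_source := by
    simp only [Set.ofPred_forall]
    exact isOpen_iInter_of_finite fun i => isOpen_iInter_of_finite fun j =>
      isOpen_iInter_of_finite fun _ =>
        isOpen_lt continuous_const ((continuous_id.matrix_elem i j).div_const _)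
  open_target := isOpen_univ
  continuousOn_toFun := by
    refine continuousOn_pi.2 fun i => continuousOn_pi.2 fun j => ?_
    have he : Continuous fun y : Matrix (Fin n) (Fin m) ℝ => y i j := continuous_id.matrix_elem i j
    by_cases h : x i j = 0
    · simpa [h] using he.continuousOn
    · simpa [h] using (he.div_const (x i j)).continuousOn.log fun y hy => (hy i j h).ne'
  continuousOn_invFun := by
    refine continuousOn_pi.2 fun i => continuousOn_pi.2 fun j => ?_
    have he : Continuous fun y : Matrix (Fin n) (Fin m) ℝ => y i j := continuous_id.matrix_elem i j
    by_cases h : x i j = 0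
    · simpa [h] using he
    · simp only [h, Matrix.of_apply, if_false]
      fun_prop

open Classical in
theorem logChart_apply (x y : Matrix (Fin n) (Fin m) ℝ) (i : Fin n) (j : Fin m) :
    logChart x y i j = if x i j = 0 then y i j else Real.log (y i j / x i j) := rfl

open Classical in
theorem logChart_symm_apply (x z : Matrix (Fin n) (Fin m) ℝ) (i : Fin n) (j : Fin m) :
    (logChart x).symm z i j = if x i j = 0 then z i j else x i j * Real.exp (z i j) := rfl

theorem contDiff_entry (i : Fin n) (j : Fin m) :
    ContDiff ℝ ∞ fun y : Matrix (Fin n) (Fin m) ℝ => y i j :=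
  contDiff_pi.1 (contDiff_pi.1 (contDiff_id (E := Fin n → Fin m → ℝ)) i) j

theorem contDiffOn_logChart (x : Matrix (Fin n) (Fin m) ℝ) :
    ContDiffOn ℝ ∞ (logChart x) (logChart x).source := by
  refine contDiffOn_pi.2 fun i => contDiffOn_pi.2 fun j => ?_
  by_cases h : x i j = 0
  · simpa only [logChart_apply, h, if_true] using (contDiff_entry i j).contDiffOn
  · have := ((contDiff_entry i j).div_const (x i j)).contDiffOn.log
      (s := (logChart x).source) fun y hy => (hy i j h).ne'
    simpa only [logChart_apply, h, if_false] using this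

theorem contDiffOn_logChart_symm (x : Matrix (Fin n) (Fin m) ℝ) :
    ContDiffOn ℝ ∞ (logChart x).symm (logChart x).target := by
  refine contDiffOn_pi.2 fun i => contDiffOn_pi.2 fun j => ?_
  by_cases h : x i j = 0
  · simpa only [logChart_symm_apply, h, if_true] using (contDiff_entry i j).contDiffOn
  · simpa only [logChart_symm_apply, h, if_false] using
      (contDiff_const.mul (contDiff_entry i j).exp).contDiffOn

theorem self_mem_logChart_source (x : Matrix (Fin n) (Fin m) ℝ) : x ∈ (logChart x).source :=
  fun i j h => by simp [div_self h]

/-- The logarithmic chart turns scaling factors into summands, hence straightens the orbit. -/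
theorem logChart_mem_range_iff {X x y : Matrix (Fin n) (Fin m) ℝ} (hx : x ∈ scalingOrbit X)
    (hy : y ∈ (logChart x).source) :
    y ∈ scalingOrbit X ↔ logChart x y ∈ LinearMap.range (edgeSum X) := by
  obtain ⟨u, v, hu, hv, rfl⟩ := hx
  have hzero : ∀ i j, scale X u v i j = 0 ↔ X i j = 0 := by
    intro i j
    simp [scale_apply, hu i, hv j]
  constructor
  · rintro ⟨u', v', hu', hv', rfl⟩
    -- The logarithm ignores signs, so the factors need not be positive.
    refine ⟨Sum.elim (fun i => Real.log (u' i / u i)) (fun j => Real.log (v' j / v j)), ?_⟩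
    ext i j
    by_cases h : X i j = 0
    · simp [edgeSum_apply, logChart_apply, scale_apply, h]
    · simp only [edgeSum_apply, logChart_apply, hzero, h, if_false, Sum.elim_inl, Sum.elim_inr]
      rw [← Real.log_mul (div_ne_zero (hu' i) (hu i)) (div_ne_zero (hv' j) (hv j))]
      congr 1
      have := hu i
      have := hv j
      simp only [scale_apply]
      field_simp
  · rintro ⟨f, hf⟩
    refine ⟨fun i => u i * Real.exp (f (Sum.inl i)), fun j => v j * Real.exp (f (Sum.inr j)),
      fun i => mul_ne_zero (hu i) (Real.exp_ne_zero _),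
      fun j => mul_ne_zero (hv j) (Real.exp_ne_zero _), ?_⟩
    ext i j
    have hij : edgeSum X f i j = _ := congrFun (congrFun hf i) j
    by_cases h : X i j = 0
    · simp only [edgeSum_apply, logChart_apply, hzero, h, if_true] at hij
      simp [scale_apply, h, ← hij]
    · simp only [edgeSum_apply, logChart_apply, hzero, h, if_false] at hij
      have hne := (hzero i j).not.2 h
      have hexp := Real.exp_log (hy i j hne)
      rw [← hij, Real.exp_add, eq_div_iff hne, scale_apply] at hexp
      rw [← hexp, scale_apply]
      ring

theorem isSmoothSubmanifold_scalingOrbit (X : Matrix (Fin n) (Fin m) ℝ) :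
    IsSmoothSubmanifold (n + m - numComponents (entryGraph X)) (scalingOrbit X) := fun x hx =>
  ⟨logChart x, LinearMap.range (edgeSum X), self_mem_logChart_source x, contDiffOn_logChart x,
    contDiffOn_logChart_symm x, finrank_range_edgeSum X, fun _ hy => logChart_mem_range_iff hx hy⟩

/-! ### The scaling manifold of a matrix -/

theorem mainTheorem5 (n m : ℕ) (X₀ : Matrix (Fin n) (Fin m) ℝ) :
    ∃ M : Set (Matrix (Fin n) (Fin m) ℝ),
      IsSmoothSubmanifold (n + m - numComponents (entryGraph X₀)) M ∧
      X₀ ∈ M ∧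
      M ⊆ {X | X.rank = X₀.rank ∧ ∀ i j, X₀ i j = 0 → X i j = 0} ∧
      ∃ V : Submodule ℝ (Matrix (Fin n) (Fin m) ℝ),
        X₀ ∈ V ∧
        (V : Set (Matrix (Fin n) (Fin m) ℝ)) ⊆ closure M ∧
        closure M ⊆ {X | X.rank ≤ X₀.rank ∧ ∀ i j, X₀ i j = 0 → X i j = 0} ∧
        max {i | X₀.row i ≠ 0}.ncard {j | X₀.col j ≠ 0}.ncard ≤ Module.finrank ℝ V := by
  refine ⟨scalingOrbit X₀, isSmoothSubmanifold_scalingOrbit X₀, self_mem_scalingOrbit X₀,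
    fun Y hY => ⟨rank_of_mem_scalingOrbit hY,
      (closure_scalingOrbit_subset X₀ (subset_closure hY)).2⟩, ?_⟩
  rcases le_total {i | X₀.row i ≠ 0}.ncard {j | X₀.col j ≠ 0}.ncard with h | h
  · refine ⟨LinearMap.range (colScale X₀), ⟨1, scale_one_one X₀⟩, ?_,
      closure_scalingOrbit_subset X₀, ?_⟩
    · rintro _ ⟨v, rfl⟩
      exact scale_mem_closure X₀ 1 v
    · rw [max_eq_right h]
      exact ncard_cols_le X₀
  · refine ⟨LinearMap.range (rowScale X₀), ⟨1, scale_one_one X₀⟩, ?_,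
      closure_scalingOrbit_subset X₀, ?_⟩
    · rintro _ ⟨u, rfl⟩
      exact scale_mem_closure X₀ u 1
    · rw [max_eq_left h]
      exact ncard_rows_le X₀
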